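/- Consider the complete graph on $n$ nodes, a set $\mathcal C$ of $f$ curious nodes, and the \emph{delayed start} protocol: the source calls $\mathrm{tell\_gossip}$ once, i.e. sends the rumor to a node $j$ chosen uniformly among all $n$ nodes, and stops emitting; then $j$ starts a standard push protocol: with $I=\{j\}$ initially, while $|I|<n$, a uniformly random sender $i\in I$ sends the rumor to a uniformly random node $j'$ among all $n$ nodes, which is added to $I$. The adversary's output is the ordered subsequence $S$ of those messages (sender, receiver) whose receiver is curious. Write $p_i$ for the law when the source $I_0$ is $\{i\}$, and let $p(\cdot\mid S)$ be the posterior for the uniform prior of the source on the $n-f$ non-curious nodes. A protocol has $c$-prediction uncertainty, $c>0$, if $p(I_0\neq\{i\}\mid S)/p(I_0=\{i\}\mid S)\ge c$ for every non-curious node $i$ and every set $S$ of outputs with $p_i(S)>0$; let $c_{ds}$ be the supremum of all such $c$ for the delayed start protocol ($0$ if there are none). Fix $\alpha\in(0,1)$ and let $n\to\infty$ along values for which $f=\alpha n$ is an integer, so that $f/n=\alpha$ is constant. Then $c_{ds}\to 0$. Moreover, the adversary has an attack (a function of the output which names a node or abstains) such that, for every $\varepsilon>0$, for all large $n$ and every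 non-curious node $i$: $p(I_0=\{i\}\mid \text{the attack names } i)\ge 1-\varepsilon$, and if $i$ is the source then, conditionally on the information leaking (the source's single initial message reaching a curious node), the attack names $i$ with probability at least $1-\varepsilon$. -/

import Mathlib

open Filter Topology
open scoped ENNReal NNReal

namespace GossipPrivacy

/-- A call `(i, j)` to the `tell_gossip` primitive on the complete graph with `n` nodes:
node `i` tells the rumor to node `j`. -/
abbrev Call (n : ℕ) : Type := Fin n × Fin n

/-- Law of the parameterized gossip loop with muting parameter `s ∈ [0, 1]`, entered with informed
set `I` and active set `A`: the probability that the loop terminates and that the complete sequence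
of its calls is the given list.  While `|I| < n`, the loop samples the sender `i` uniformly in `A`,
removes `i` from `A` with probability `1 - s`, samples the receiver `j` uniformly among all `n`
nodes, and inserts `j` into both `I` and `A`. -/
noncomputable def loopProb {n : ℕ} (s : ℝ≥0∞) :
    Finset (Fin n) → Finset (Fin n) → List (Call n) → ℝ≥0∞
  | I, _, [] => if I.card < n then 0 else 1
  | I, A, (i, j) :: ω =>
      if I.card < n ∧ i ∈ A then
        (A.card : ℝ≥0∞)⁻¹ * (n : ℝ≥0∞)⁻¹ *
          (s * loopProb s (insert j I) (insert j A) ω +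
            (1 - s) * loopProb s (insert j I) (insert j (A.erase i)) ω)
      else 0

/-- Law of the sequence of calls of parameterized gossip started at node `k`. -/
noncomputable def parameterizedGossip {n : ℕ} (s : ℝ≥0∞) (k : Fin n) (ω : List (Call n)) : ℝ≥0∞ :=
  loopProb s {k} {k} ω

/-- Law of the sequence of calls of standard push (nodes never stop emitting) started at `k`. -/
noncomputable def standardPush {n : ℕ} (k : Fin n) (ω : List (Call n)) : ℝ≥0∞ :=
  parameterizedGossip 1 k ω

/-- Law of the sequence of all calls of the delayed start protocol: the source calls `tell_gossip`
once, which picks a uniform node `j`, and then node `j` starts a standard push protocol. -/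
noncomputable def delayedStart {n : ℕ} (source : Fin n) : List (Call n) → ℝ≥0∞
  | [] => 0
  | (i, j) :: ω => if i = source then (n : ℝ≥0∞)⁻¹ * standardPush j ω else 0

/-- The probability of a set of executions, when `P source` is the law of the sequence of calls. -/
noncomputable def execProb {n : ℕ} (P : Fin n → List (Call n) → ℝ≥0∞) (source : Fin n)
    (Ω : Set (List (Call n))) : ℝ≥0∞ :=
  ∑' ω : Ω, P source ω

/-- The output seen by the adversary: the ordered subsequence of the calls whose receiver is a
curious node. -/
def observed {n : ℕ} (C : Finset (Fin n)) (ω : List (Call n)) : List (Call n) :=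
  ω.filter fun call => call.2 ∈ C

/-- `p_i(S)`: the probability that the output belongs to `S` when the source is `i`. -/
noncomputable def outputProb {n : ℕ} (P : Fin n → List (Call n) → ℝ≥0∞) (C : Finset (Fin n))
    (i : Fin n) (S : Set (List (Call n))) : ℝ≥0∞ :=
  execProb P i (observed C ⁻¹' S)

/-- `p(I₀ ∈ B, output ∈ S)` for the uniform prior on the non-curious nodes. -/
noncomputable def jointProb {n : ℕ} (P : Fin n → List (Call n) → ℝ≥0∞) (C B : Finset (Fin n))
    (S : Set (List (Call n))) : ℝ≥0∞ :=
  ∑ i ∈ B \ C, (Cᶜ.card : ℝ≥0∞)⁻¹ * outputProb P C i S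

/-- `p(I₀ ∈ B | output ∈ S)` for the uniform prior on the non-curious nodes. -/
noncomputable def posterior {n : ℕ} (P : Fin n → List (Call n) → ℝ≥0∞) (C B : Finset (Fin n))
    (S : Set (List (Call n))) : ℝ≥0∞ :=
  jointProb P C B S / jointProb P C Finset.univ S

/-- `c`-prediction uncertainty: `p(I₀ ≠ {i} | S) / p(I₀ = {i} | S) ≥ c` for every possible source
`i` and every set `S` of outputs with `p_i(S) > 0`. -/
def PredictionUncertainty {n : ℕ} (P : Fin n → List (Call n) → ℝ≥0∞) (C : Finset (Fin n))
    (c : ℝ≥0) : Prop :=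
  ∀ i ∉ C, ∀ S : Set (List (Call n)), 0 < outputProb P C i S →
    (c : ℝ≥0∞) ≤ posterior P C {i}ᶜ S / posterior P C {i} S

/-- The prediction uncertainty constant: the supremum of the `c > 0` for which the protocol satisfies
`c`-prediction uncertainty (`0` if there are none). -/
noncomputable def uncertaintyConstant {n : ℕ} (P : Fin n → List (Call n) → ℝ≥0∞)
    (C : Finset (Fin n)) : ℝ≥0∞ :=
  ⨆ (c : ℝ≥0) (_ : 0 < c ∧ PredictionUncertainty P C c), (c : ℝ≥0∞)

/-- The executions in which the information leaks: the very first call reaches a curious node. -/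
def leak {n : ℕ} (C : Finset (Fin n)) : Set (List (Call n)) :=
  {ω | ∃ call ∈ ω.head?, call.2 ∈ C}

end GossipPrivacy

/-! The attack names the first observed sender, provided that it sends none of the next `t` observed
calls, where `t = Nat.sqrt f`.

If the source's call reaches a curious node, the source does not yet know the rumor as far as the
push protocol is concerned. Each call reaches it with probability `1/n` and a curious node with
probability `f/n`, so it is informed before `t` further observations with probability at most `t/f`,
which tends to `0`. Hence the attack names the source with probability at least about `α`.

If that call is not observed, the first observed sender is an informed node, and silence is
unlikely. While `m` nodes are informed, it makes an observed call with probability `α/m`. To stay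
silent until `M` nodes are informed it must survive factors `1 - α/k`, whose product vanishes as `M`
grows because the harmonic series diverges. Otherwise it is silent for `t` observations, each of
which it sends with probability at least `1/M`. `silenceBound` adds the two cases, and
`pushProb_isSome_firstSenderAttack_le` extends the bound to a random first observation.

A wrong naming of `i` by source `l` needs a non-curious first receiver `j`. Swapping `i` and `j`
turns "push from `j` names `i`" into "push from `i` names `j`" (`pushProb_names_comm`). Summed over
`j` and `l`, wrong namings of `i` thus weigh at most the probability that push from `i` names
anyone, which tends to `0`. Comparing this with the correct namings bounds the posterior odds and
gives both claims. -/

namespace GossipPrivacy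

variable {n : ℕ}

/-! ### Standard push: one-step recursion, termination, inductive bounds -/

/-- The probability that the calls made by standard push, entered with informed set `I`, form a
list in `E`. -/
noncomputable def pushProb (I : Finset (Fin n)) (E : Set (List (Call n))) : ℝ≥0∞ :=
  ∑' ω : E, loopProb 1 I I ω

theorem pushProb_eq_tsum_indicator (I : Finset (Fin n)) (E : Set (List (Call n))) :
    pushProb I E = ∑' ω, E.indicator (loopProb 1 I I) ω :=
  tsum_subtype E _

theorem pushProb_mono (I : Finset (Fin n)) {E F : Set (List (Call n))} (h : E ⊆ F) :
    pushProb I E ≤ pushProb I F :=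
  ENNReal.tsum_mono_subtype _ h

@[simp]
theorem pushProb_empty (I : Finset (Fin n)) : pushProb I ∅ = 0 := by
  simp [pushProb]

theorem pushProb_add_compl (I : Finset (Fin n)) (E : Set (List (Call n))) :
    pushProb I E + pushProb I Eᶜ = pushProb I Set.univ := by
  rw [pushProb_eq_tsum_indicator, pushProb_eq_tsum_indicator, pushProb_eq_tsum_indicator,
    ← ENNReal.tsum_add]
  refine tsum_congr fun ω => ?_
  rw [Set.indicator_univ]
  exact congrFun (Set.indicator_self_add_compl E (loopProb 1 I I)) ω

/-- A list is either empty or consists of a head and a tail. -/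
def listEquivSum (α : Type*) : List α ≃ Unit ⊕ (α × List α) where
  toFun
    | [] => Sum.inl ()
    | a :: l => Sum.inr (a, l)
  invFun
    | Sum.inl _ => []
    | Sum.inr (a, l) => a :: l
  left_inv l := by cases l <;> rfl
  right_inv o := by rcases o with _ | _ <;> rfl

theorem tsum_list_eq {α : Type*} (f : List α → ℝ≥0∞) :
    ∑' l, f l = f [] + ∑' a, ∑' l, f (a :: l) := by
  rw [← (listEquivSum α).symm.tsum_eq f,
    Summable.tsum_sum ENNReal.summable ENNReal.summable, ← ENNReal.tsum_prod]
  simp [listEquivSum]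

theorem loopProb_one_nil (I : Finset (Fin n)) :
    loopProb 1 I I [] = if I.card < n then 0 else 1 := by
  simp [loopProb]

theorem loopProb_one_cons (I : Finset (Fin n)) (i j : Fin n) (ω : List (Call n)) :
    loopProb 1 I I ((i, j) :: ω) = if I.card < n ∧ i ∈ I then
      (I.card : ℝ≥0∞)⁻¹ * (n : ℝ≥0∞)⁻¹ * loopProb 1 (insert j I) (insert j I) ω else 0 := by
  simp [loopProb]

theorem pushProb_of_card_lt {I : Finset (Fin n)} (hI : I.card < n) (E : Set (List (Call n))) :
    pushProb I E = ∑ i ∈ I, ∑ j, (I.card : ℝ≥0∞)⁻¹ * (n : ℝ≥0∞)⁻¹ *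
      pushProb (insert j I) {ω | (i, j) :: ω ∈ E} := by
  classical
  rw [pushProb_eq_tsum_indicator, tsum_list_eq, tsum_fintype, Fintype.sum_prod_type]
  have h0 : E.indicator (loopProb 1 I I) [] = 0 := by
    simp [Set.indicator_apply, loopProb_one_nil, hI]
  rw [h0, zero_add, ← Finset.sum_subset (Finset.subset_univ I)]
  · refine Finset.sum_congr rfl fun i hi => Finset.sum_congr rfl fun j _ => ?_
    rw [pushProb_eq_tsum_indicator, ← ENNReal.tsum_mul_left]
    refine tsum_congr fun ω => ?_
    simp only [Set.indicator_apply, Set.mem_ofPred_eq, loopProb_one_cons, hI, hi, and_self,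
      if_true, mul_ite, mul_zero]
  · intro i _ hi
    refine Finset.sum_eq_zero fun j _ => ?_
    simp [Set.indicator_apply, loopProb_one_cons, hi]

theorem pushProb_of_card_eq {I : Finset (Fin n)} (hI : I.card = n) (E : Set (List (Call n))) :
    pushProb I E = E.indicator 1 [] := by
  classical
  rw [pushProb_eq_tsum_indicator, tsum_list_eq, tsum_fintype, Fintype.sum_prod_type]
  simp [Set.indicator_apply, loopProb_one_nil, loopProb_one_cons, hI]

/-- It suffices to bound the probability of the lists of bounded length. -/
theorem pushProb_le_of_forall_length_lt {I : Finset (Fin n)} {E : Set (List (Call n))}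
    {c : ℝ≥0∞} (h : ∀ L : ℕ, pushProb I (E ∩ {ω | ω.length < L}) ≤ c) : pushProb I E ≤ c := by
  classical
  rw [pushProb_eq_tsum_indicator, ENNReal.tsum_eq_iSup_sum]
  refine iSup_le fun s => ?_
  refine le_trans ?_ (h (s.sup List.length + 1))
  rw [pushProb_eq_tsum_indicator]
  refine le_trans (Finset.sum_le_sum fun ω hω => ?_) (ENNReal.sum_le_tsum s)
  have hlen : ω.length < s.sup List.length + 1 := Nat.lt_succ_of_le (Finset.le_sup hω)
  simp only [Set.indicator_apply, Set.mem_inter_iff, Set.mem_ofPred_eq, hlen, and_true, le_refl]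

/-- One step of the inductive bound on the probability of a set of executions: `v i j` bounds the
probability of the remaining calls after the call `(i, j)`. -/
theorem pushProb_inter_succ_le {I : Finset (Fin n)} (hI : I.Nonempty) {E : Set (List (Call n))}
    {L : ℕ} {c : ℝ} (v : Fin n → Fin n → ℝ) (hv : ∀ i j, 0 ≤ v i j)
    (hnil : I.card = n → [] ∈ E → 1 ≤ c)
    (hstep : I.card < n → ∀ i ∈ I, ∀ j,
      pushProb (insert j I) ({ω | (i, j) :: ω ∈ E} ∩ {ω | ω.length < L}) ≤ ENNReal.ofReal (v i j))
    (hsum : I.card < n → ∑ i ∈ I, ∑ j, v i j ≤ I.card * n * c) :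
    pushProb I (E ∩ {ω | ω.length < L + 1}) ≤ ENNReal.ofReal c := by
  classical
  have hcard : I.card ≤ n := by simpa using Finset.card_le_univ I
  rcases hcard.eq_or_lt with hIn | hIn
  · rw [pushProb_of_card_eq hIn, Set.indicator_apply]
    split_ifs with hmem
    · simpa using hnil hIn hmem.1
    · exact zero_le
  · have hpos : 0 < I.card := hI.card_pos
    have hn : 0 < n := hpos.trans hIn
    rw [pushProb_of_card_lt hIn]
    simp_rw [← Finset.mul_sum]
    have key : ∑ i ∈ I, ∑ j, pushProb (insert j I)
        {ω | (i, j) :: ω ∈ E ∩ {ω | ω.length < L + 1}} ≤ ENNReal.ofReal (I.card * n * c) := by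
      refine le_trans ?_ (ENNReal.ofReal_le_ofReal (hsum hIn))
      rw [ENNReal.ofReal_sum_of_nonneg fun i _ => Finset.sum_nonneg fun j _ => hv i j]
      refine Finset.sum_le_sum fun i hi => ?_
      rw [ENNReal.ofReal_sum_of_nonneg fun j _ => hv i j]
      refine Finset.sum_le_sum fun j _ => ?_
      refine (pushProb_mono _ fun ω hω => ?_).trans (hstep hIn i hi j)
      exact ⟨hω.1, Nat.lt_of_succ_lt_succ hω.2⟩
    have hc : ENNReal.ofReal (I.card * n * c) = (I.card : ℝ≥0∞) * n * ENNReal.ofReal c := by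
      rw [ENNReal.ofReal_mul (by positivity), ENNReal.ofReal_mul (by positivity),
        ENNReal.ofReal_natCast, ENNReal.ofReal_natCast]
    rw [hc] at key
    have h1 : (I.card : ℝ≥0∞) ≠ 0 := by exact_mod_cast hpos.ne'
    have h2 : (n : ℝ≥0∞) ≠ 0 := by exact_mod_cast hn.ne'
    rw [← ENNReal.mul_inv (Or.inl h1) (Or.inr h2)]
    rw [mul_comm, ← div_eq_mul_inv]
    refine ENNReal.div_le_of_le_mul ?_
    rwa [mul_comm (ENNReal.ofReal c)]

theorem pushProb_le_one {I : Finset (Fin n)} (hI : I.Nonempty) (E : Set (List (Call n))) :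
    pushProb I E ≤ 1 := by
  refine pushProb_le_of_forall_length_lt fun L => ?_
  rw [← ENNReal.ofReal_one]
  induction L generalizing I E with
  | zero => simp
  | succ L ih =>
    refine pushProb_inter_succ_le hI (fun _ _ => 1) (fun _ _ => zero_le_one) (fun _ _ => le_rfl)
      (fun _ i _ j => ih (Finset.insert_nonempty j I) _) fun _ => ?_
    simp

/-- Standard push terminates almost surely. -/
theorem pushProb_univ {I : Finset (Fin n)} (hI : I.Nonempty) : pushProb I Set.univ = 1 := by
  classical
  induction h : n - I.card using Nat.strong_induction_on generalizing I with
  | _ d ih =>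
  have hcard : I.card ≤ n := by simpa using Finset.card_le_univ I
  rcases hcard.eq_or_lt with hIn | hIn
  · simp [pushProb_of_card_eq hIn]
  have hpos : 0 < I.card := hI.card_pos
  have hn : 0 < n := hpos.trans hIn
  have hfin : pushProb I Set.univ ≠ ⊤ := ((pushProb_le_one hI _).trans_lt ENNReal.one_lt_top).ne
  have hrec := pushProb_of_card_lt hIn Set.univ
  simp only [Set.mem_univ, Set.ofPred_true] at hrec
  -- Only calls to new nodes enlarge `I`, and those are covered by induction; the others return the
  -- unknown itself, which gives a linear equation.
  have hins : ∀ j, pushProb (insert j I) Set.univ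
      = if j ∈ I then pushProb I Set.univ else 1 := by
    intro j
    split_ifs with hj
    · rw [Finset.insert_eq_of_mem hj]
    · refine ih _ ?_ (Finset.insert_nonempty j I) rfl
      rw [Finset.card_insert_of_notMem hj]
      omega
  simp only [hins, ← Finset.mul_sum, Finset.sum_const, nsmul_eq_mul] at hrec
  rw [Finset.sum_ite, Finset.sum_const, Finset.sum_const] at hrec
  have e1 : (Finset.univ.filter fun j => j ∈ I) = I := by ext; simp
  have e2 : (Finset.univ.filter fun j => j ∉ I) = Iᶜ := by ext; simp
  rw [e1, e2] at hrec
  have hcompl : (Iᶜ.card : ℝ) = n - I.card := by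
    rw [Finset.card_compl, Fintype.card_fin, Nat.cast_sub hcard]
  have hreal := congrArg ENNReal.toReal hrec
  rw [← ENNReal.toReal_eq_one_iff]
  generalize hx : (pushProb I Set.univ).toReal = x at hreal ⊢
  have hx1 : ((I.card • pushProb I Set.univ + Iᶜ.card • (1 : ℝ≥0∞))).toReal
      = I.card * x + (n - I.card) := by
    rw [nsmul_eq_mul, nsmul_eq_mul, mul_one, ENNReal.toReal_add
      (ENNReal.mul_ne_top (ENNReal.natCast_ne_top _) hfin) (ENNReal.natCast_ne_top _),
      ENNReal.toReal_mul, ENNReal.toReal_natCast, ENNReal.toReal_natCast, hcompl, hx]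
  rw [ENNReal.toReal_mul, ENNReal.toReal_mul, ENNReal.toReal_inv, ENNReal.toReal_mul, hx1] at hreal
  simp only [ENNReal.toReal_natCast, ENNReal.toReal_inv] at hreal
  have hp : (0 : ℝ) < I.card := by exact_mod_cast hpos
  have hnr : (0 : ℝ) < n := by exact_mod_cast hn
  have hlt : (I.card : ℝ) < n := by exact_mod_cast hIn
  generalize (I.card : ℝ) = a at *
  generalize (n : ℝ) = b at *
  have hcancel : b * (a⁻¹ * b⁻¹ * (a * (a * x + (b - a)))) = a * x + (b - a) := by
    field_simp
  rw [← hreal] at hcancel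
  -- The equation is `b * x = a * x + (b - a)` with `a < b`. Finiteness from `pushProb_le_one` is
  -- what allows the passage to real numbers.
  have : (b - a) * (x - 1) = 0 := by linarith
  rcases mul_eq_zero.1 this with h0 | h0 <;> linarith

/-! ### Invariance of push under relabelling of the nodes -/

theorem loopProb_one_map (σ : Equiv.Perm (Fin n)) (I : Finset (Fin n)) (ω : List (Call n)) :
    loopProb 1 (I.map σ.toEmbedding) (I.map σ.toEmbedding) (ω.map (Prod.map σ σ)) =
      loopProb 1 I I ω := by
  induction ω generalizing I with
  | nil => simp [loopProb_one_nil]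
  | cons c ω ih =>
    obtain ⟨i, j⟩ := c
    have h := ih (insert j I)
    rw [Finset.map_insert] at h
    simp only [Equiv.coe_toEmbedding] at h
    simp [loopProb_one_cons, h]

theorem pushProb_map (σ : Equiv.Perm (Fin n)) (I : Finset (Fin n)) (E : Set (List (Call n))) :
    pushProb (I.map σ.toEmbedding) E = pushProb I {ω | ω.map (Prod.map σ σ) ∈ E} := by
  classical
  rw [pushProb_eq_tsum_indicator, pushProb_eq_tsum_indicator,
    ← (Equiv.listEquivOfEquiv (Equiv.prodCongr σ σ)).tsum_eq]
  refine tsum_congr fun ω => ?_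
  have : Equiv.listEquivOfEquiv (Equiv.prodCongr σ σ) ω = ω.map (Prod.map σ σ) := rfl
  rw [this]
  simp only [Set.indicator_apply, Set.mem_ofPred_eq, loopProb_one_map]

/-! ### The attack and the silence events -/

/-- The attack with patience `t`: name the sender of the first observed call, provided that at least
`t` further calls are observed and that this node sends none of the next `t` observed calls. -/
def firstSenderAttack (t : ℕ) : List (Call n) → Option (Fin n)
  | [] => none
  | c :: S => if t ≤ S.length ∧ ∀ d ∈ S.take t, d.1 ≠ c.1 then some c.1 else none

/-- The executions in which at least `t` calls are observed, the first `t` of which are not sent by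
the node `a`. -/
def silentFor (C : Finset (Fin n)) (a : Fin n) (t : ℕ) : Set (List (Call n)) :=
  {ω | t ≤ (observed C ω).length ∧ ∀ d ∈ (observed C ω).take t, d.1 ≠ a}

theorem observed_cons_of_mem {C : Finset (Fin n)} {i j : Fin n} (hj : j ∈ C)
    (ω : List (Call n)) : observed C ((i, j) :: ω) = (i, j) :: observed C ω := by
  simp [observed, hj]

theorem observed_cons_of_notMem {C : Finset (Fin n)} {i j : Fin n} (hj : j ∉ C)
    (ω : List (Call n)) : observed C ((i, j) :: ω) = observed C ω := by
  simp [observed, hj]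

theorem silentFor_zero (C : Finset (Fin n)) (a : Fin n) : silentFor C a 0 = Set.univ := by
  simp [silentFor]

theorem cons_mem_silentFor_succ {C : Finset (Fin n)} {a i j : Fin n} (hj : j ∈ C) {t : ℕ}
    {ω : List (Call n)} :
    (i, j) :: ω ∈ silentFor C a (t + 1) ↔ i ≠ a ∧ ω ∈ silentFor C a t := by
  simp only [silentFor, Set.mem_ofPred_eq, observed_cons_of_mem hj, List.length_cons,
    List.take_succ_cons, List.mem_cons, forall_eq_or_imp]
  constructor
  · rintro ⟨h1, h2, h3⟩
    exact ⟨h2, by omega, h3⟩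
  · rintro ⟨h2, h1, h3⟩
    exact ⟨by omega, h2, h3⟩

theorem cons_mem_silentFor_of_notMem {C : Finset (Fin n)} {a i j : Fin n} (hj : j ∉ C) {t : ℕ}
    {ω : List (Call n)} : (i, j) :: ω ∈ silentFor C a t ↔ ω ∈ silentFor C a t := by
  simp only [silentFor, Set.mem_ofPred_eq, observed_cons_of_notMem hj]

theorem firstSenderAttack_observed_cons {C : Finset (Fin n)} {a i j : Fin n} (hj : j ∈ C) {t : ℕ}
    {ω : List (Call n)} : firstSenderAttack t (observed C ((i, j) :: ω)) = some a ↔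
      i = a ∧ ω ∈ silentFor C a t := by
  rw [observed_cons_of_mem hj, firstSenderAttack]
  split_ifs with h
  · simp only [Option.some.injEq]
    constructor
    · rintro rfl
      exact ⟨rfl, h⟩
    · exact And.left
  · simp only [false_iff]
    rintro ⟨rfl, h'⟩
    exact h h'

theorem firstSenderAttack_map (σ : Equiv.Perm (Fin n)) (t : ℕ) (S : List (Call n)) :
    firstSenderAttack t (S.map (Prod.map σ σ)) = (firstSenderAttack t S).map σ := by
  cases S with
  | nil => rfl
  | cons c S =>
    simp only [List.map_cons, firstSenderAttack, List.length_map, ← List.map_take,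
      List.forall_mem_map, Prod.map_fst, ne_eq, EmbeddingLike.apply_eq_iff_eq]
    split_ifs <;> rfl

theorem observed_map {C : Finset (Fin n)} {σ : Equiv.Perm (Fin n)} (hσ : ∀ i, σ i ∈ C ↔ i ∈ C)
    (ω : List (Call n)) :
    observed C (ω.map (Prod.map σ σ)) = (observed C ω).map (Prod.map σ σ) := by
  simp only [observed, List.filter_map]
  congr 2
  ext c
  simp [hσ]

theorem sum_univ_ite_mem {C : Finset (Fin n)} (x y : ℝ) :
    ∑ j : Fin n, (if j ∈ C then x else y) = C.card * x + (n - C.card) * y := by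
  classical
  rw [Finset.sum_ite, Finset.sum_const, Finset.sum_const]
  have e1 : (Finset.univ.filter fun j => j ∈ C) = C := by ext; simp
  have e2 : (Finset.univ.filter fun j => j ∉ C) = Cᶜ := by ext; simp
  have hle : C.card ≤ n := by simpa using Finset.card_le_univ C
  rw [e1, e2, nsmul_eq_mul, nsmul_eq_mul, Finset.card_compl, Fintype.card_fin, Nat.cast_sub hle]

/-- A node which is not informed yet stays silent with high probability. -/
theorem pushProb_compl_silentFor_le {C : Finset (Fin n)} (hC : C.Nonempty) {a : Fin n}
    (haC : a ∉ C) {I : Finset (Fin n)} (hI : I.Nonempty) (haI : a ∉ I) (t : ℕ) :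
    pushProb I (silentFor C a t)ᶜ ≤ ENNReal.ofReal (t / C.card) := by
  classical
  have hf : (0 : ℝ) < C.card := by exact_mod_cast hC.card_pos
  refine pushProb_le_of_forall_length_lt fun L => ?_
  induction L generalizing I t with
  | zero => simp
  | succ L ih =>
    cases t with
    | zero => simp [silentFor_zero]
    | succ t =>
      refine pushProb_inter_succ_le hI
        -- A call to `a` is charged the trivial bound `1`. Averaging over receivers, this extra
        -- `1/n` exactly balances the gain `1/f` made with probability `f/n`.
        (fun _ j => (if j ∈ C then (t : ℝ) / C.card else (t + 1 : ℕ) / C.card) +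
          if j = a then 1 else 0)
        (fun _ j => by positivity) ?_ ?_ ?_
      -- The loop cannot end before `a` is informed, so too few observations never cause failure by
      -- themselves.
      · intro hcard
        rw [(Finset.card_eq_iff_eq_univ I).1 (by simpa using hcard)] at haI
        simp at haI
      · intro _ i hi j
        by_cases hja : j = a
        · refine (pushProb_le_one (Finset.insert_nonempty _ _) _).trans ?_
          rw [← ENNReal.ofReal_one]
          refine ENNReal.ofReal_le_ofReal ?_
          rw [if_pos hja]
          have : (0 : ℝ) ≤ if j ∈ C then (t : ℝ) / C.card else (t + 1 : ℕ) / C.card := by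
            positivity
          linarith
        · have hins : a ∉ insert j I := by
            rw [Finset.mem_insert, not_or]
            exact ⟨fun h => hja h.symm, haI⟩
          have hia : i ≠ a := fun h => haI (h ▸ hi)
          rw [if_neg hja, add_zero]
          split_ifs with hjC
          · refine (pushProb_mono _ ?_).trans (ih (Finset.insert_nonempty j I) hins t)
            rintro ω ⟨h1, h2⟩
            exact ⟨fun h => h1 ((cons_mem_silentFor_succ hjC).2 ⟨hia, h⟩), h2⟩
          · refine (pushProb_mono _ ?_).trans (ih (Finset.insert_nonempty j I) hins (t + 1))
            rintro ω ⟨h1, h2⟩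
            exact ⟨fun h => h1 ((cons_mem_silentFor_of_notMem hjC).2 h), h2⟩
      · intro _
        rw [Finset.sum_const, nsmul_eq_mul, mul_assoc]
        refine mul_le_mul_of_nonneg_left (le_of_eq ?_) (Nat.cast_nonneg _)
        rw [Finset.sum_add_distrib, Finset.sum_ite_eq', if_pos (Finset.mem_univ a),
          sum_univ_ite_mem]
        push_cast
        field_simp
        ring

/-! ### Weights controlling survival while the informed set grows -/

/-- A weight with `w (m + 1) * (1 - α / m) = w m`. -/
noncomputable def weight (α : ℝ) (m : ℕ) : ℝ := ∏ k ∈ Finset.Ico 1 m, (1 - α / k)⁻¹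

section weight

variable {α : ℝ}

theorem one_sub_div_pos (hα1 : α < 1) {m : ℕ} (hm : 1 ≤ m) : 0 < 1 - α / m := by
  have h : (1 : ℝ) ≤ m := by exact_mod_cast hm
  have : α / m < 1 := by
    rw [div_lt_one (by linarith)]
    linarith
  linarith

theorem weight_succ {m : ℕ} (hm : 1 ≤ m) :
    weight α (m + 1) = weight α m * (1 - α / m)⁻¹ :=
  Finset.prod_Ico_succ_top hm _

theorem weight_succ_mul (hα1 : α < 1) {m : ℕ} (hm : 1 ≤ m) :
    weight α (m + 1) * (1 - α / m) = weight α m := by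
  rw [weight_succ hm, inv_mul_cancel_right₀ (one_sub_div_pos hα1 hm).ne']

theorem weight_pos (hα1 : α < 1) (m : ℕ) : 0 < weight α m :=
  Finset.prod_pos fun _ hk => inv_pos.2 (one_sub_div_pos hα1 (Finset.mem_Ico.1 hk).1)

theorem weight_mul_le_weight_succ (hα1 : α < 1) {m : ℕ} (hm : 1 ≤ m) :
    weight α m * (1 + α / m) ≤ weight α (m + 1) := by
  rw [weight_succ hm]
  refine mul_le_mul_of_nonneg_left ?_ (weight_pos hα1 m).le
  rw [← one_div, le_div_iff₀ (one_sub_div_pos hα1 hm)]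
  nlinarith [sq_nonneg (α / m)]

theorem monotone_weight (hα0 : 0 < α) (hα1 : α < 1) : Monotone (weight α) := by
  refine monotone_nat_of_le_succ fun m => ?_
  rcases Nat.eq_zero_or_pos m with rfl | hm
  · simp [weight]
  · refine le_trans ?_ (weight_mul_le_weight_succ hα1 hm)
    refine le_mul_of_one_le_right (weight_pos hα1 m).le ?_
    have : 0 ≤ α / m := by positivity
    linarith

/-- Each factor satisfies `(1 - x)⁻¹ ≥ 1 + x`, so the product dominates a harmonic sum and diverges.
-/
theorem one_add_le_weight (hα0 : 0 < α) (hα1 : α < 1) (m : ℕ) :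
    1 + α * ∑ k ∈ Finset.range m, 1 / ((k : ℝ) + 1) ≤ weight α (m + 1) := by
  induction m with
  | zero => simp [weight]
  | succ m ih =>
    refine le_trans ?_ (weight_mul_le_weight_succ hα1 (Nat.succ_pos m))
    rw [Finset.sum_range_succ]
    have h1 : 1 ≤ weight α (m + 1) := by
      refine le_trans ?_ (monotone_weight hα0 hα1 (Nat.zero_le _))
      simp [weight]
    have h2 : 0 ≤ α / ((m : ℝ) + 1) := by positivity
    push_cast
    have h3 := mul_le_mul_of_nonneg_right h1 h2
    have h4 : α * (1 / ((m : ℝ) + 1)) = α / (m + 1) := by ring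
    nlinarith

theorem tendsto_weight (hα0 : 0 < α) (hα1 : α < 1) : Tendsto (weight α) atTop atTop := by
  rw [← tendsto_add_atTop_iff_nat 1]
  refine tendsto_atTop_mono (one_add_le_weight hα0 hα1) ?_
  exact tendsto_atTop_add_const_left _ _
    (Real.tendsto_sum_range_one_div_nat_succ_atTop.const_mul_atTop hα0)

end weight

/-! ### Silence of informed nodes -/

/-- The bound on the probability that an informed node is silent for `t` observed calls, when `m`
nodes are informed. -/
noncomputable def silenceBound (α : ℝ) (M m t : ℕ) : ℝ :=
  min 1 (weight α m / weight α M + (1 - 1 / M) ^ t)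

section silenceBound

variable {α : ℝ}

theorem one_sub_inv_nonneg {M : ℕ} (hM : 1 ≤ M) : (0 : ℝ) ≤ 1 - 1 / M := by
  have h : (1 : ℝ) ≤ M := by exact_mod_cast hM
  have := (div_le_one (by linarith : (0 : ℝ) < M)).2 h
  linarith

theorem silenceBound_nonneg (hα1 : α < 1) {M : ℕ} (hM : 1 ≤ M) (m t : ℕ) :
    0 ≤ silenceBound α M m t := by
  have h1 := (weight_pos hα1 m).le
  have h2 := (weight_pos hα1 M).le
  have h3 := pow_nonneg (one_sub_inv_nonneg hM) t
  have h4 := div_nonneg h1 h2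
  exact le_min zero_le_one (by linarith)

theorem silenceBound_mono (hα0 : 0 < α) (hα1 : α < 1) {M m m' : ℕ} (h : m ≤ m') (t : ℕ) :
    silenceBound α M m t ≤ silenceBound α M m' t := by
  unfold silenceBound
  have := div_le_div_of_nonneg_right (monotone_weight hα0 hα1 h) (weight_pos hα1 M).le
  gcongr

theorem silenceBound_zero (hα1 : α < 1) (M m : ℕ) : silenceBound α M m 0 = 1 := by
  have := div_nonneg (weight_pos hα1 m).le (weight_pos hα1 M).le
  rw [silenceBound, pow_zero, min_eq_left (by linarith)]

/-- One call with `m` informed nodes: `α * (1 - 1 / m)` is an observed call by another sender, `1 -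
α` an unobserved call. The missing mass `α / m` is the node's own observed call, which ends its
silence. The weight term is preserved exactly by `weight_succ_mul`. -/
theorem silenceBound_step (hα0 : 0 < α) (hα1 : α < 1) {M m : ℕ} (hm : 1 ≤ m) (hM : 1 ≤ M) (t : ℕ) :
    α * (1 - 1 / m) * silenceBound α M (m + 1) t + (1 - α) * silenceBound α M (m + 1) (t + 1) ≤
      silenceBound α M m (t + 1) := by
  have hm' : (1 : ℝ) ≤ m := by exact_mod_cast hm
  have hinv := one_sub_inv_nonneg hm
  have hinv1 : (0 : ℝ) ≤ 1 / m := by positivity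
  have hc1 : 0 ≤ α * (1 - 1 / (m : ℝ)) := mul_nonneg hα0.le hinv
  have hc2 : 0 ≤ 1 - α := by linarith
  refine le_min ?_ ?_
  · have h1 := mul_le_mul_of_nonneg_left (min_le_left 1
      (weight α (m + 1) / weight α M + (1 - 1 / M) ^ t)) hc1
    have h2 := mul_le_mul_of_nonneg_left (min_le_left 1
      (weight α (m + 1) / weight α M + (1 - 1 / M) ^ (t + 1))) hc2
    unfold silenceBound
    nlinarith
  -- Beyond `M` the comparison of `1 - 1 / m` with `1 - 1 / M` fails, but there the weight ratio is
  -- already at least `1`, and the cap at `1` suffices.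
  · rcases le_or_gt M m with hMm | hMm
    · have h0 : 1 ≤ weight α m / weight α M :=
        (one_le_div (weight_pos hα1 M)).2 (monotone_weight hα0 hα1 hMm)
      have h1 := mul_le_mul_of_nonneg_left (min_le_left 1
        (weight α (m + 1) / weight α M + (1 - 1 / M) ^ t)) hc1
      have h2 := mul_le_mul_of_nonneg_left (min_le_left 1
        (weight α (m + 1) / weight α M + (1 - 1 / M) ^ (t + 1))) hc2
      have h3 := pow_nonneg (one_sub_inv_nonneg hM) (t + 1)
      unfold silenceBound
      nlinarith
    · have h1 := mul_le_mul_of_nonneg_left (min_le_right 1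
        (weight α (m + 1) / weight α M + (1 - 1 / M) ^ t)) hc1
      have h2 := mul_le_mul_of_nonneg_left (min_le_right 1
        (weight α (m + 1) / weight α M + (1 - 1 / M) ^ (t + 1))) hc2
      have hw := weight_succ_mul hα1 hm
      have hw' : weight α (m + 1) / weight α M * (1 - α / m) = weight α m / weight α M := by
        rw [← hw]; ring
      have hρ : α * (1 - 1 / m) * (1 - 1 / (M : ℝ)) ^ t ≤ α * (1 - 1 / (M : ℝ)) ^ (t + 1) := by
        rw [pow_succ, mul_assoc]
        refine mul_le_mul_of_nonneg_left ?_ hα0.le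
        rw [mul_comm]
        refine mul_le_mul_of_nonneg_left ?_ (pow_nonneg (one_sub_inv_nonneg hM) t)
        have hlt : (m : ℝ) ≤ M := by exact_mod_cast hMm.le
        have := one_div_le_one_div_of_le (by linarith) hlt
        linarith
      have h3 : α * (1 - 1 / (m : ℝ)) * (weight α (m + 1) / weight α M) +
          (1 - α) * (weight α (m + 1) / weight α M) = weight α m / weight α M := by
        rw [← hw']; ring
      unfold silenceBound
      linarith

end silenceBound

variable {α : ℝ}

/-- An informed node is unlikely to stay silent. -/
theorem pushProb_silentFor_le (hα0 : 0 < α) (hα1 : α < 1) {C : Finset (Fin n)}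
    (hC : (C.card : ℝ) = α * n) {M : ℕ} (hM : 1 ≤ M) {a : Fin n} {I : Finset (Fin n)}
    (ha : a ∈ I) (t : ℕ) :
    pushProb I (silentFor C a t) ≤ ENNReal.ofReal (silenceBound α M I.card t) := by
  classical
  refine pushProb_le_of_forall_length_lt fun L => ?_
  induction L generalizing I t with
  | zero => simp
  | succ L ih =>
    cases t with
    | zero =>
      rw [silenceBound_zero hα1, ENNReal.ofReal_one]
      exact pushProb_le_one ⟨a, ha⟩ _
    | succ t =>
      have ih' : ∀ j t, pushProb (insert j I) (silentFor C a t ∩ {ω | ω.length < L}) ≤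
          ENNReal.ofReal (silenceBound α M (I.card + 1) t) := fun j t =>
        (ih (Finset.mem_insert_of_mem ha) t).trans (ENNReal.ofReal_le_ofReal
          (silenceBound_mono hα0 hα1 (Finset.card_insert_le _ _) t))
      refine pushProb_inter_succ_le ⟨a, ha⟩
        (fun i j => if j ∈ C then (if i = a then 0 else silenceBound α M (I.card + 1) t)
          else silenceBound α M (I.card + 1) (t + 1))
        (fun i j => ?_) ?_ ?_ ?_
      · have := silenceBound_nonneg hα1 hM (I.card + 1) t
        have := silenceBound_nonneg hα1 hM (I.card + 1) (t + 1)
        positivity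
      · intro _ h
        -- An execution that ends with too few observations does not count as silence.
        simp [silentFor, observed] at h
      · intro _ i _ j
        split_ifs with hjC hia
        · rw [Set.eq_empty_of_forall_notMem (s := {ω | (i, j) :: ω ∈ silentFor C a (t + 1)})
            fun ω hω => ((cons_mem_silentFor_succ hjC).1 hω).1 hia]
          simp
        · refine (pushProb_mono _ ?_).trans (ih' j t)
          rintro ω ⟨h1, h2⟩
          exact ⟨((cons_mem_silentFor_succ hjC).1 h1).2, h2⟩
        · refine (pushProb_mono _ ?_).trans (ih' j (t + 1))
          rintro ω ⟨h1, h2⟩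
          exact ⟨(cons_mem_silentFor_of_notMem hjC).1 h1, h2⟩
      · intro _
        have hm : 1 ≤ I.card := Finset.card_pos.2 ⟨a, ha⟩
        have hm' : (1 : ℝ) ≤ I.card := by exact_mod_cast hm
        simp_rw [sum_univ_ite_mem]
        rw [Finset.sum_add_distrib, Finset.sum_const, ← Finset.mul_sum,
          ← Finset.sum_erase_add _ _ ha, if_pos rfl, add_zero,
          Finset.sum_congr rfl fun i hi => if_neg (Finset.ne_of_mem_erase hi), Finset.sum_const,
          Finset.card_erase_of_mem ha, nsmul_eq_mul, nsmul_eq_mul, Nat.cast_sub hm, hC]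
        have h := mul_le_mul_of_nonneg_left (silenceBound_step hα0 hα1 hm hM t)
          (by positivity : (0 : ℝ) ≤ I.card * n)
        refine le_trans (le_of_eq ?_) h
        field_simp
        push_cast
        ring

/-- When standard push is entered with few informed nodes, the attack is unlikely to name anyone. -/
theorem pushProb_isSome_firstSenderAttack_le (hα0 : 0 < α) (hα1 : α < 1) {C : Finset (Fin n)}
    (hC : (C.card : ℝ) = α * n) {M : ℕ} (hM : 1 ≤ M) {I : Finset (Fin n)}
    (hI : I.Nonempty) (t : ℕ) :
    pushProb I {ω | ∃ a, firstSenderAttack t (observed C ω) = some a} ≤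
      ENNReal.ofReal (2 * weight α (I.card + 1) / weight α M + (1 - 1 / M) ^ t) := by
  classical
  have hnn : ∀ m, 0 ≤ 2 * weight α m / weight α M + (1 - 1 / (M : ℝ)) ^ t := fun m => by
    have h1 := (weight_pos hα1 m).le
    have h2 := (weight_pos hα1 M).le
    have h3 := pow_nonneg (one_sub_inv_nonneg hM) t
    positivity
  refine pushProb_le_of_forall_length_lt fun L => ?_
  induction L generalizing I with
  | zero => simp
  | succ L ih =>
    refine pushProb_inter_succ_le hI
      (fun i j => if j ∈ C then silenceBound α M (I.card + 1) t
        else 2 * weight α (I.card + 2) / weight α M + (1 - 1 / M) ^ t)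
      (fun i j => ?_) ?_ ?_ ?_
    · have := silenceBound_nonneg hα1 hM (I.card + 1) t
      have := hnn (I.card + 2)
      positivity
    · rintro _ ⟨a, ha⟩
      simp [observed, firstSenderAttack] at ha
    · intro _ i hi j
      split_ifs with hjC
      · refine (pushProb_mono _ ?_).trans
          ((pushProb_silentFor_le hα0 hα1 hC hM (Finset.mem_insert_of_mem (b := j) hi) t).trans
            (ENNReal.ofReal_le_ofReal
              (silenceBound_mono hα0 hα1 (Finset.card_insert_le _ _) t)))
        rintro ω ⟨⟨a, h1⟩, h2⟩
        obtain ⟨rfl, h⟩ := (firstSenderAttack_observed_cons hjC).1 h1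
        exact h
      · refine (pushProb_mono _ ?_).trans ((ih (Finset.insert_nonempty j I)).trans
          (ENNReal.ofReal_le_ofReal ?_))
        · rintro ω ⟨⟨a, h1⟩, h2⟩
          rw [observed_cons_of_notMem hjC] at h1
          exact ⟨⟨a, h1⟩, h2⟩
        · have := monotone_weight hα0 hα1
            (show (insert j I).card + 1 ≤ I.card + 2 from
              Nat.succ_le_succ (Finset.card_insert_le j I))
          have := weight_pos hα1 M
          gcongr
    · intro _
      have hm : 1 ≤ I.card := hI.card_pos
      have hm' : (1 : ℝ) ≤ I.card := by exact_mod_cast hm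
      simp_rw [sum_univ_ite_mem]
      rw [Finset.sum_const, nsmul_eq_mul, hC, mul_assoc (I.card : ℝ)]
      refine mul_le_mul_of_nonneg_left ?_ (Nat.cast_nonneg _)
      have hs : silenceBound α M (I.card + 1) t ≤
          weight α (I.card + 1) / weight α M + (1 - 1 / M) ^ t := min_le_right _ _
      have hw : weight α (I.card + 2) * (1 - α / ((I.card + 1 : ℕ) : ℝ)) = weight α (I.card + 1) :=
        weight_succ_mul hα1 (Nat.succ_pos I.card)
      -- The factor `2` and the shift to `I.card + 1` pay for the random number of informed nodes at
      -- the first observation: as `I.card + 1 ≥ 2`, it is enough that `2 * (1 - α) ≤ (2 - α) * (1 -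
      -- α / 2)`.
      have hstep : (1 - α) * (2 * weight α (I.card + 2)) ≤ (2 - α) * weight α (I.card + 1) := by
        rw [← hw]
        have hpos := weight_pos hα1 (I.card + 2)
        have h1 : α / ((I.card + 1 : ℕ) : ℝ) ≤ α / 2 := by
          push_cast
          gcongr
          linarith
        have h2 : (1 - α) * 2 ≤ (2 - α) * (1 - α / ((I.card + 1 : ℕ) : ℝ)) := by nlinarith
        nlinarith
      have hstep' : (1 - α) * (2 * weight α (I.card + 2) / weight α M) ≤
          (2 - α) * (weight α (I.card + 1) / weight α M) := by
        rw [← mul_div_assoc, ← mul_div_assoc]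
        exact div_le_div_of_nonneg_right hstep (weight_pos hα1 M).le
      have hα' := mul_le_mul_of_nonneg_left hs hα0.le
      have hfin : α * silenceBound α M (I.card + 1) t +
          (1 - α) * (2 * weight α (I.card + 2) / weight α M + (1 - 1 / (M : ℝ)) ^ t) ≤
          2 * weight α (I.card + 1) / weight α M + (1 - 1 / (M : ℝ)) ^ t := by
        rw [mul_div_assoc 2 (weight α (I.card + 1))]
        linarith
      have := mul_le_mul_of_nonneg_left hfin (n.cast_nonneg : (0 : ℝ) ≤ n)
      linarith

/-! ### Correct and wrong namings under delayed start -/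

theorem execProb_delayedStart (i : Fin n) (Ω : Set (List (Call n))) :
    execProb delayedStart i Ω = (n : ℝ≥0∞)⁻¹ * ∑ j, pushProb {j} {ω | (i, j) :: ω ∈ Ω} := by
  classical
  rw [execProb, tsum_subtype, tsum_list_eq, tsum_fintype, Fintype.sum_prod_type,
    Finset.sum_eq_single i]
  · simp only [Set.indicator_apply, delayedStart, if_true, ite_self, zero_add]
    rw [Finset.mul_sum]
    refine Finset.sum_congr rfl fun j _ => ?_
    rw [pushProb_eq_tsum_indicator, ← ENNReal.tsum_mul_left]
    refine tsum_congr fun ω => ?_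
    simp only [Set.indicator_apply, Set.mem_ofPred_eq, mul_ite, mul_zero]
    rfl
  · intro k _ hk
    refine Finset.sum_eq_zero fun j _ => ?_
    simp [Set.indicator_apply, delayedStart, hk]
  · simp

/-- The executions in which the attack with patience `t` names the node `i`. -/
abbrev names (C : Finset (Fin n)) (t : ℕ) (i : Fin n) : Set (List (Call n)) :=
  {ω | firstSenderAttack t (observed C ω) = some i}

theorem execProb_leak (C : Finset (Fin n)) (i : Fin n) :
    execProb delayedStart i (leak C) = (n : ℝ≥0∞)⁻¹ * C.card := by
  classical
  rw [execProb_delayedStart, ← Finset.sum_subset (Finset.subset_univ C)]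
  · rw [Finset.sum_congr rfl fun j hj => ?_, Finset.sum_const, nsmul_eq_mul, mul_one]
    rw [← pushProb_univ (Finset.singleton_nonempty j)]
    congr 1
    ext ω
    simp [leak, hj]
  · intro j _ hj
    have : {ω | (i, j) :: ω ∈ leak C} = ∅ := by
      ext ω
      simp [leak, hj]
    rw [this, pushProb_empty]

/-- If the information leaks, then the attack names the source with high probability. -/
theorem le_execProb_leak_inter_names {C : Finset (Fin n)} {i : Fin n} (hi : i ∉ C) (t : ℕ) :
    (n : ℝ≥0∞)⁻¹ * C.card * (1 - ENNReal.ofReal (t / C.card)) ≤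
      execProb delayedStart i (leak C ∩ names C t i) := by
  classical
  rw [execProb_delayedStart, mul_assoc]
  refine mul_le_mul_right ?_ _
  refine le_trans ?_ (Finset.sum_le_sum_of_subset (Finset.subset_univ C))
  rw [← nsmul_eq_mul, ← Finset.sum_const]
  refine Finset.sum_le_sum fun j hj => ?_
  have hij : i ∉ ({j} : Finset (Fin n)) := fun h => hi (Finset.mem_singleton.1 h ▸ hj)
  have hcompl := pushProb_compl_silentFor_le ⟨j, hj⟩ hi (Finset.singleton_nonempty j) hij t
  rw [tsub_le_iff_right, ← pushProb_univ (Finset.singleton_nonempty j),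
    ← pushProb_add_compl {j} (silentFor C i t)]
  refine add_le_add (pushProb_mono _ fun ω hω => ⟨?_, ?_⟩) hcompl
  · simp [leak, hj]
  · exact (firstSenderAttack_observed_cons hj).2 ⟨rfl, hω⟩

/-- Swapping two non-curious nodes preserves `C`, and both push and the attack commute with the
swap. -/
theorem pushProb_names_comm {C : Finset (Fin n)} {i j : Fin n} (hi : i ∉ C) (hj : j ∉ C) (t : ℕ) :
    pushProb {j} (names C t i) = pushProb {i} (names C t j) := by
  have hσ : ∀ k, Equiv.swap i j k ∈ C ↔ k ∈ C := by
    intro k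
    rcases eq_or_ne k i with rfl | hki
    · simp [hi, hj]
    rcases eq_or_ne k j with rfl | hkj
    · simp [hi, hj]
    rw [Equiv.swap_apply_of_ne_of_ne hki hkj]
  have h := pushProb_map (Equiv.swap i j) {i} (names C t i)
  rw [Finset.map_singleton, Equiv.coe_toEmbedding, Equiv.swap_apply_left] at h
  rw [h]
  congr 1
  ext ω
  simp only [Set.mem_ofPred_eq, observed_map hσ, firstSenderAttack_map, Option.map_eq_some_iff]
  constructor
  · rintro ⟨a, ha, hai⟩
    rw [ha, Equiv.swap_apply_eq_iff.1 hai, Equiv.swap_apply_left]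
  · intro h
    exact ⟨j, h, Equiv.swap_apply_right i j⟩

/-- The attack names at most one node, so the events are disjoint. -/
theorem sum_pushProb_names_le {C : Finset (Fin n)} (I : Finset (Fin n)) (t : ℕ) :
    ∑ j, pushProb I (names C t j) ≤
      pushProb I {ω | ∃ a, firstSenderAttack t (observed C ω) = some a} := by
  classical
  simp_rw [pushProb_eq_tsum_indicator]
  rw [← tsum_fintype (L := .unconditional _), ENNReal.tsum_comm]
  refine ENNReal.tsum_le_tsum fun ω => ?_
  rw [tsum_fintype]
  cases h : firstSenderAttack t (observed C ω) with
  | none => simp [h]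
  | some a => simp [Set.indicator_apply, h]

/-- The total probability that the attack names `i` while another node is the source. -/
theorem sum_outputProb_names_le {C : Finset (Fin n)} {i : Fin n} (hi : i ∉ C) (t : ℕ) :
    ∑ l ∈ {i}ᶜ \ C, outputProb delayedStart C l {S | firstSenderAttack t S = some i} ≤
      pushProb {i} {ω | ∃ a, firstSenderAttack t (observed C ω) = some a} := by
  classical
  have hn : (n : ℝ≥0∞) ≠ 0 := by exact_mod_cast (i.pos).ne'
  have key : ∀ l ∈ {i}ᶜ \ C, outputProb delayedStart C l {S | firstSenderAttack t S = some i} ≤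
      (n : ℝ≥0∞)⁻¹ * pushProb {i} {ω | ∃ a, firstSenderAttack t (observed C ω) = some a} := by
    intro l hl
    have hli : l ≠ i := by
      rintro rfl
      simp at hl
    rw [outputProb, execProb_delayedStart]
    refine mul_le_mul_right (le_trans (Finset.sum_le_sum fun j _ => ?_)
      (sum_pushProb_names_le (C := C) {i} t)) _
    -- If the first call is observed, the only node that can be named is its sender `l ≠ i`.
    by_cases hj : j ∈ C
    · have hempty : {ω | (l, j) :: ω ∈ names C t i} = ∅ :=
        Set.eq_empty_of_forall_notMem fun ω hω =>
          hli ((firstSenderAttack_observed_cons hj).1 hω).1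
      exact (congrArg _ hempty).trans_le (by simp)
    · rw [← pushProb_names_comm hi hj]
      refine pushProb_mono _ fun ω hω => ?_
      simpa [observed_cons_of_notMem hj] using hω
  refine (Finset.sum_le_card_nsmul _ _ _ key).trans ?_
  rw [nsmul_eq_mul, ← mul_assoc]
  refine mul_le_of_le_one_left' ?_
  -- At most `n` sources are summed, which cancels the factor `1/n` of the first call.
  have hcard : ((({i}ᶜ \ C : Finset (Fin n)).card : ℕ) : ℝ≥0∞) ≤ n := by
    exact_mod_cast (Finset.card_le_univ _).trans_eq (Fintype.card_fin n)
  refine (mul_le_mul_left hcard _).trans ?_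
  rw [ENNReal.mul_inv_cancel hn (ENNReal.natCast_ne_top n)]

theorem execProb_delayedStart_le_one (i : Fin n) (Ω : Set (List (Call n))) :
    execProb delayedStart i Ω ≤ 1 := by
  have hn : (n : ℝ≥0∞) ≠ 0 := by exact_mod_cast (i.pos).ne'
  rw [execProb_delayedStart]
  refine (mul_le_mul_right (Finset.sum_le_card_nsmul _ _ 1 fun j _ =>
    pushProb_le_one (Finset.singleton_nonempty j) _) _).trans ?_
  simp [ENNReal.inv_mul_cancel hn (ENNReal.natCast_ne_top n)]

/-! ### From output probabilities to posterior odds -/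

section posterior

variable {P : Fin n → List (Call n) → ℝ≥0∞} {C : Finset (Fin n)} {i : Fin n}

theorem jointProb_eq (B : Finset (Fin n)) (S : Set (List (Call n))) :
    jointProb P C B S = (Cᶜ.card : ℝ≥0∞)⁻¹ * ∑ l ∈ B \ C, outputProb P C l S := by
  rw [jointProb, Finset.mul_sum]

theorem jointProb_singleton (hi : i ∉ C) (S : Set (List (Call n))) :
    jointProb P C {i} S = (Cᶜ.card : ℝ≥0∞)⁻¹ * outputProb P C i S := by
  rw [jointProb_eq, Finset.sdiff_eq_self_of_disjoint (by simpa using hi), Finset.sum_singleton]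

theorem jointProb_add_compl (B : Finset (Fin n)) (S : Set (List (Call n))) :
    jointProb P C B S + jointProb P C Bᶜ S = jointProb P C Finset.univ S := by
  rw [jointProb, jointProb, jointProb, ← Finset.sum_union]
  · rw [← Finset.union_sdiff_distrib, Finset.union_compl]
  · exact (disjoint_compl_right (a := B)).mono Finset.sdiff_subset Finset.sdiff_subset

/-- The posterior odds against a possible source. -/
theorem posterior_compl_div_posterior (hP : ∀ l S, outputProb P C l S ≠ ⊤) (hi : i ∉ C)
    {S : Set (List (Call n))} (hS : outputProb P C i S ≠ 0) :
    posterior P C {i}ᶜ S / posterior P C {i} S =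
      (∑ l ∈ {i}ᶜ \ C, outputProb P C l S) / outputProb P C i S := by
  have hc0 : (Cᶜ.card : ℝ≥0∞) ≠ 0 := by
    have : 0 < Cᶜ.card := Finset.card_pos.2 ⟨i, by simpa using hi⟩
    exact_mod_cast this.ne'
  have hci : (Cᶜ.card : ℝ≥0∞)⁻¹ ≠ ⊤ := ENNReal.inv_ne_top.2 hc0
  have hci0 : (Cᶜ.card : ℝ≥0∞)⁻¹ ≠ 0 := ENNReal.inv_ne_zero.2 (ENNReal.natCast_ne_top _)
  have htop : ∀ B, jointProb P C B S ≠ ⊤ := fun B => by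
    rw [jointProb_eq]
    exact ENNReal.mul_ne_top hci (ENNReal.sum_ne_top.2 fun l _ => hP l S)
  have huniv : jointProb P C Finset.univ S ≠ 0 := by
    rw [← jointProb_add_compl {i}, jointProb_singleton hi]
    intro h
    exact mul_ne_zero hci0 hS (add_eq_zero.1 h).1
  rw [posterior, posterior,
    ENNReal.div_eq_inv_mul (b := jointProb P C Finset.univ S) (a := jointProb P C {i} S),
    ENNReal.div_eq_inv_mul (b := jointProb P C Finset.univ S),
    ENNReal.mul_div_mul_left _ _ (ENNReal.inv_ne_zero.2 (htop _)) (ENNReal.inv_ne_top.2 huniv),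
    jointProb_singleton hi, jointProb_eq, ENNReal.mul_div_mul_left _ _ hci0 hci]

/-- If the odds against a possible source are small, then its posterior probability is near one. -/
theorem one_sub_le_posterior (hP : ∀ l S, outputProb P C l S ≠ ⊤) (hi : i ∉ C)
    {S : Set (List (Call n))} (hS : outputProb P C i S ≠ 0) {ε : ℝ≥0∞}
    (h : ∑ l ∈ {i}ᶜ \ C, outputProb P C l S ≤ ε * outputProb P C i S) :
    1 - ε ≤ posterior P C {i} S := by
  have hc0 : (Cᶜ.card : ℝ≥0∞) ≠ 0 := by
    have : 0 < Cᶜ.card := Finset.card_pos.2 ⟨i, by simpa using hi⟩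
    exact_mod_cast this.ne'
  have hci : (Cᶜ.card : ℝ≥0∞)⁻¹ ≠ ⊤ := ENNReal.inv_ne_top.2 hc0
  have hci0 : (Cᶜ.card : ℝ≥0∞)⁻¹ ≠ 0 := ENNReal.inv_ne_zero.2 (ENNReal.natCast_ne_top _)
  have htop : ∀ B, jointProb P C B S ≠ ⊤ := fun B => by
    rw [jointProb_eq]
    exact ENNReal.mul_ne_top hci (ENNReal.sum_ne_top.2 fun l _ => hP l S)
  have h0 : jointProb P C {i} S ≠ 0 := by
    rw [jointProb_singleton hi]
    exact mul_ne_zero hci0 hS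
  have huniv : jointProb P C Finset.univ S ≠ 0 := by
    rw [← jointProb_add_compl {i}]
    exact fun h => h0 (add_eq_zero.1 h).1
  rw [posterior, ENNReal.le_div_iff_mul_le (Or.inl huniv) (Or.inl (htop _)), ENNReal.sub_mul
    (fun _ _ => htop _), one_mul, tsub_le_iff_right, ← jointProb_add_compl {i}]
  refine add_le_add le_rfl ?_
  have hle : jointProb P C {i}ᶜ S ≤ ε * jointProb P C {i} S := by
    rw [jointProb_eq, jointProb_singleton hi, mul_left_comm]
    exact mul_le_mul_right h _
  rw [mul_add]
  exact hle.trans le_self_add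

end posterior

/-! ### Asymptotics with patience `Nat.sqrt f` -/

theorem outputProb_delayedStart_ne_top (C : Finset (Fin n)) (i : Fin n)
    (S : Set (List (Call n))) : outputProb delayedStart C i S ≠ ⊤ :=
  ((execProb_delayedStart_le_one i _).trans_lt ENNReal.one_lt_top).ne

theorem execProb_leak_eq_ofReal {α : ℝ} {C : Finset (Fin n)} (hC : (C.card : ℝ) = α * n)
    (i : Fin n) : execProb delayedStart i (leak C) = ENNReal.ofReal α := by
  have hn : (0 : ℝ) < n := by exact_mod_cast i.pos
  rw [execProb_leak, mul_comm, ← div_eq_mul_inv, ← ENNReal.ofReal_natCast n,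
    ← ENNReal.ofReal_natCast C.card, ← ENNReal.ofReal_div_of_pos hn, hC,
    mul_div_cancel_right₀ _ hn.ne']

theorem le_outputProb_names {α : ℝ} {C : Finset (Fin n)} (hC : (C.card : ℝ) = α * n)
    {i : Fin n} (hi : i ∉ C) {t : ℕ} (ht : (t : ℝ) / C.card ≤ 1 / 2) :
    ENNReal.ofReal (α / 2) ≤
      outputProb delayedStart C i {S | firstSenderAttack t S = some i} := by
  have h := le_execProb_leak_inter_names hi t
  rw [← execProb_leak C i, execProb_leak_eq_ofReal hC] at h
  refine le_trans ?_ (h.trans (ENNReal.tsum_mono_subtype _ Set.inter_subset_right))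
  have h1 : ENNReal.ofReal (1 / 2) ≤ 1 - ENNReal.ofReal (t / C.card) := by
    rw [← ENNReal.ofReal_one, ← ENNReal.ofReal_sub _ (by positivity)]
    exact ENNReal.ofReal_le_ofReal (by linarith)
  rw [div_eq_mul_one_div, ENNReal.ofReal_mul' (by norm_num)]
  exact mul_le_mul_right h1 _

theorem sum_outputProb_names_le_ofReal {α : ℝ} (hα0 : 0 < α) (hα1 : α < 1) {C : Finset (Fin n)}
    (hC : (C.card : ℝ) = α * n) {i : Fin n} (hi : i ∉ C) {M : ℕ} (hM : 1 ≤ M) (t : ℕ) :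
    ∑ l ∈ {i}ᶜ \ C, outputProb delayedStart C l {S | firstSenderAttack t S = some i} ≤
      ENNReal.ofReal (2 * weight α 2 / weight α M + (1 - 1 / M) ^ t) :=
  (sum_outputProb_names_le hi t).trans
    (pushProb_isSome_firstSenderAttack_le hα0 hα1 hC hM (Finset.singleton_nonempty i) t)

/-- The patience must tend to infinity, to expose informed senders, and be `o(f)`, to spare a
leaking source; the square root does both. -/
theorem natSqrt_div_le (m : ℕ) : (m.sqrt : ℝ) / m ≤ 1 / m.sqrt := by
  rcases Nat.eq_zero_or_pos m with rfl | hm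
  · simp
  have hs : (0 : ℝ) < m.sqrt := by exact_mod_cast Nat.sqrt_pos.2 hm
  have hm' : (0 : ℝ) < m := by exact_mod_cast hm
  rw [div_le_div_iff₀ hm' hs, one_mul]
  exact_mod_cast Nat.sqrt_le m

theorem tendsto_natSqrt_atTop : Tendsto Nat.sqrt atTop atTop :=
  tendsto_atTop.2 fun b => (eventually_ge_atTop (b * b)).mono fun _ h => Nat.le_sqrt.2 h

theorem card_eq_mul_of_div_eq {α : ℝ} (hα0 : 0 < α) {C : Finset (Fin n)}
    (hC : (C.card : ℝ) / (n : ℝ) = α) : (C.card : ℝ) = α * n := by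
  have hn : (n : ℝ) ≠ 0 := by
    intro h
    rw [h, div_zero] at hC
    exact hα0.ne hC
  rw [← hC, div_mul_cancel₀ _ hn]

section asymptotics

variable {α : ℝ} {n : ℕ → ℕ} {C : ∀ k, Finset (Fin (n k))}

theorem tendsto_sqrt_card (hα0 : 0 < α) (hn : Tendsto n atTop atTop)
    (hC : ∀ k, ((C k).card : ℝ) = α * n k) :
    Tendsto (fun k => (C k).card.sqrt) atTop atTop := by
  refine tendsto_natSqrt_atTop.comp ?_
  rw [← tendsto_natCast_atTop_iff (R := ℝ)]
  simp_rw [hC]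
  exact (tendsto_natCast_atTop_atTop.comp hn).const_mul_atTop hα0

theorem tendsto_sqrt_card_div_card (hα0 : 0 < α) (hn : Tendsto n atTop atTop)
    (hC : ∀ k, ((C k).card : ℝ) = α * n k) :
    Tendsto (fun k => ((C k).card.sqrt : ℝ) / (C k).card) atTop (𝓝 0) :=
  squeeze_zero (fun _ => by positivity) (fun k => natSqrt_div_le (C k).card)
    (tendsto_one_div_atTop_nhds_zero_nat.comp (tendsto_sqrt_card hα0 hn hC))

/-- The posterior odds against the node named by the attack tend to zero. -/
theorem eventually_sum_outputProb_le (hα0 : 0 < α) (hα1 : α < 1) (hn : Tendsto n atTop atTop)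
    (hC : ∀ k, ((C k).card : ℝ) = α * n k) {ε : ℝ≥0∞} (hε : 0 < ε) :
    ∀ᶠ k in atTop, ∀ i ∉ C k,
      outputProb delayedStart (C k) i {S | firstSenderAttack (C k).card.sqrt S = some i} ≠ 0 ∧
      ∑ l ∈ {i}ᶜ \ C k,
        outputProb delayedStart (C k) l {S | firstSenderAttack (C k).card.sqrt S = some i} ≤
      ε * outputProb delayedStart (C k) i {S | firstSenderAttack (C k).card.sqrt S = some i} := by
  obtain ⟨e, he0, heε⟩ := ENNReal.lt_iff_exists_nnreal_btwn.1 hε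
  have he : (0 : ℝ) < e := by exact_mod_cast he0
  have hη : 0 < e * (α / 2) / 2 := by positivity
  -- `M` is fixed before `k`: it makes the weight term small, and then the growing patience makes
  -- `(1 - 1 / M) ^ t` small. Each gets half of `e * (α / 2)`, where `α / 2` bounds the correct
  -- namings from below.
  obtain ⟨M, hM, hM1⟩ := (((tendsto_weight hα0 hα1).const_div_atTop
    (2 * weight α 2)).eventually_lt_const hη |>.and (eventually_ge_atTop 1)).exists
  have hρ : (1 : ℝ) - 1 / M < 1 := by
    have : (0 : ℝ) < 1 / M := by positivity
    linarith
  have hpow := ((tendsto_pow_atTop_nhds_zero_of_lt_one (one_sub_inv_nonneg hM1) hρ).comp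
    (tendsto_sqrt_card hα0 hn hC)).eventually_lt_const hη
  have hhalf := (tendsto_sqrt_card_div_card hα0 hn hC).eventually_lt_const
    (by norm_num : (0 : ℝ) < 1 / 2)
  filter_upwards [hpow, hhalf] with k hk1 hk2 i hi
  have hlow := le_outputProb_names (hC k) hi hk2.le
  refine ⟨fun h0 => ?_, ?_⟩
  · rw [h0] at hlow
    exact absurd hlow (not_le.2 (ENNReal.ofReal_pos.2 (by positivity)))
  · refine (sum_outputProb_names_le_ofReal hα0 hα1 (hC k) hi hM1 _).trans ?_
    refine le_trans ?_ (mul_le_mul' heε.le hlow)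
    rw [← ENNReal.ofReal_coe_nnreal, ← ENNReal.ofReal_mul he.le]
    refine ENNReal.ofReal_le_ofReal ?_
    simp only [Function.comp_apply] at hk1
    linarith

end asymptotics

end GossipPrivacy

theorem mainTheorem7 (α : ℝ) (hα0 : 0 < α) (hα1 : α < 1)
    (n : ℕ → ℕ) (hn : Tendsto n atTop atTop)
    (C : ∀ k, Finset (Fin (n k)))
    (hC : ∀ k, ((C k).card : ℝ) / (n k : ℝ) = α) :
    -- the prediction uncertainty constant of the delayed start protocol tends to zero
    Tendsto (fun k => GossipPrivacy.uncertaintyConstant GossipPrivacy.delayedStart (C k))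
      atTop (𝓝 0) ∧
    -- some attack is right with probability near one whenever it names a node, and, when the
    -- information leaks, it names the source with probability near one
    ∃ attack : ∀ k, List (GossipPrivacy.Call (n k)) → Option (Fin (n k)),
      ∀ ε : ℝ≥0∞, 0 < ε → ∀ᶠ k in atTop, ∀ i ∉ C k,
        1 - ε ≤ GossipPrivacy.posterior GossipPrivacy.delayedStart (C k) {i}
          {S | attack k S = some i} ∧
        (1 - ε) * GossipPrivacy.execProb GossipPrivacy.delayedStart i (GossipPrivacy.leak (C k)) ≤
          GossipPrivacy.execProb GossipPrivacy.delayedStart i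
            (GossipPrivacy.leak (C k) ∩
              {ω | attack k (GossipPrivacy.observed (C k) ω) = some i}) := by
  have hC' : ∀ k, ((C k).card : ℝ) = α * n k := fun k =>
    GossipPrivacy.card_eq_mul_of_div_eq hα0 (hC k)
  refine ⟨ENNReal.tendsto_nhds_zero.2 fun ε hε => ?_,
    fun k => GossipPrivacy.firstSenderAttack (C k).card.sqrt, fun ε hε => ?_⟩
  · filter_upwards [GossipPrivacy.eventually_sum_outputProb_le hα0 hα1 hn hC' hε,
      hn.eventually_gt_atTop 0] with k hk hnk
    have hnk' : (0 : ℝ) < n k := by exact_mod_cast hnk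
    -- Since `α < 1`, some node is non-curious; its odds alone bound every admissible `c`.
    have hlt : (C k).card < Fintype.card (Fin (n k)) := by
      rw [Fintype.card_fin, ← Nat.cast_lt (α := ℝ), hC' k]
      nlinarith
    obtain ⟨i, hi⟩ : ∃ i, i ∉ C k := by
      by_contra! h
      rw [Finset.eq_univ_of_forall h, Finset.card_univ] at hlt
      exact lt_irrefl _ hlt
    obtain ⟨h0, hsum⟩ := hk i hi
    refine iSup₂_le fun c hc => (hc.2 i hi _ (pos_iff_ne_zero.2 h0)).trans ?_
    rw [GossipPrivacy.posterior_compl_div_posterior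
      (GossipPrivacy.outputProb_delayedStart_ne_top (C k)) hi h0]
    exact ENNReal.div_le_of_le_mul hsum
  · have hsmall := (ENNReal.tendsto_ofReal
      (GossipPrivacy.tendsto_sqrt_card_div_card hα0 hn hC')).eventually_le_const
        (by rwa [ENNReal.ofReal_zero] : ENNReal.ofReal 0 < ε)
    filter_upwards [GossipPrivacy.eventually_sum_outputProb_le hα0 hα1 hn hC' hε, hsmall]
      with k hk hkε i hi
    obtain ⟨h0, hsum⟩ := hk i hi
    refine ⟨GossipPrivacy.one_sub_le_posterior
      (GossipPrivacy.outputProb_delayedStart_ne_top (C k)) hi h0 hsum, ?_⟩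
    refine le_trans ?_ (GossipPrivacy.le_execProb_leak_inter_names hi _)
    rw [GossipPrivacy.execProb_leak, mul_comm]
    exact mul_le_mul_right (tsub_le_tsub_left hkε 1) _
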